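/- Let $\Xi$ be the unique positive solution of $\Xi\tanh\frac1\Xi+\operatorname{sech}^2\frac1\Xi=\Xi$ and let $\omega=\frac{1}{\Xi\cosh(1/\Xi)}$. Let $h,r>0$ satisfy $\frac hr\le\omega$ and let $c>r^2$. Then the transcendental equation $$\cosh\frac{2h}{E}=\frac{-2r^2+E^2-2c}{E\sqrt{E^2-4c}}$$ has a unique solution $E>0$ (the right-hand side being defined for $E^2>4c$). Moreover, with $\gamma=c/r^2>1$, the function $$\Psi_\gamma:(2\sqrt\gamma,\gamma+1]\to\mathbb R,\qquad \Psi_\gamma(e)=\frac e2\,\operatorname{arccosh}\frac{-2\gamma+e^2-2}{e\sqrt{e^2-4\gamma}},$$ is well defined (the argument of $\operatorname{arccosh}$ is at least $1$ on this interval) and strictly decreasing. -/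

import Mathlib

namespace CatenaryBVP

/-- The equation `Ξ tanh (1/Ξ) + sech² (1/Ξ) = Ξ`. -/
def XiEquation (x : ℝ) : Prop :=
  x * Real.tanh (1 / x) + (1 / Real.cosh (1 / x)) ^ 2 = x

theorem xiEquation_iff {x : ℝ} (hx : 0 < x) :
    XiEquation x ↔ 2 * (1 / x) - 1 - Real.exp (-(2 * (1 / x))) = 0 := by
  obtain ⟨t, ht, rfl⟩ : ∃ t : ℝ, 0 < t ∧ x = 1 / t := ⟨1 / x, by positivity, by simp⟩
  have hc := Real.cosh_pos t
  have h1 : Real.cosh t - Real.sinh t = Real.exp (-t) := Real.cosh_sub_sinh t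
  have h2 : Real.exp (-(2 * t)) = Real.exp (-t) ^ 2 := by
    rw [← Real.exp_nat_mul]; congr 1; push_cast; ring
  have h3 := Real.cosh_sq t
  have h4 : Real.exp (-(2 * t)) = 2 * (Real.cosh t ^ 2 - Real.sinh t * Real.cosh t) - 1 := by
    rw [h2, ← h1]; nlinarith
  unfold XiEquation
  rw [one_div_one_div, h4, Real.tanh_eq_sinh_div_cosh]
  field_simp
  constructor <;> intro h <;> linarith

/-- The defining equation of `Ξ` has exactly one positive solution. -/
theorem existsUnique_Xi : ∃! x : ℝ, 0 < x ∧ XiEquation x := by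
  have hmono : StrictMono (fun t : ℝ => 2 * t - 1 - Real.exp (-(2 * t))) := by
    intro a b hab
    have : Real.exp (-(2 * b)) < Real.exp (-(2 * a)) := Real.exp_lt_exp.2 (by linarith)
    simp only
    linarith
  have hcont : ContinuousOn (fun t : ℝ => 2 * t - 1 - Real.exp (-(2 * t))) (Set.Icc 0 1) := by
    fun_prop
  have hmem : (0 : ℝ) ∈ Set.Ioo (2 * (0 : ℝ) - 1 - Real.exp (-(2 * 0)))
      (2 * 1 - 1 - Real.exp (-(2 * 1))) := by
    have h1 : Real.exp (-(2 * 1)) < 1 := Real.exp_lt_one_iff.2 (by norm_num)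
    have h0 := Real.exp_pos (-(2 * 0))
    constructor <;> linarith
  obtain ⟨t, ht, h0⟩ := intermediate_value_Ioo (zero_le_one' ℝ) hcont hmem
  refine ⟨1 / t, ⟨one_div_pos.2 ht.1, ?_⟩, ?_⟩
  · rw [xiEquation_iff (one_div_pos.2 ht.1), one_div_one_div]
    exact h0
  · rintro y ⟨hy, hye⟩
    rw [xiEquation_iff hy] at hye
    have : 1 / y = t := hmono.injective (hye.trans h0.symm)
    rw [← this, one_div_one_div]

/-- `Ξ`, the unique positive solution of `XiEquation`. -/
noncomputable def Xi : ℝ := Classical.choose existsUnique_Xi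

/-- `ω = 1 / (Ξ cosh (1/Ξ))`. -/
noncomputable def omega : ℝ := 1 / (Xi * Real.cosh (1 / Xi))

/-- The right-hand side `(-2r² + E² - 2c) / (E √(E² - 4c))` of the transcendental equation;
it is meaningful when `E > 0` and `E² > 4c`. -/
noncomputable def concaveRHS (r c E : ℝ) : ℝ :=
  (-2 * r ^ 2 + E ^ 2 - 2 * c) / (E * √(E ^ 2 - 4 * c))

/-- The interval `(2√γ, γ + 1]` on which `Ψ_γ` is defined. -/
def PsiDomain (γ : ℝ) : Set ℝ := Set.Ioc (2 * √γ) (γ + 1)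

/-- The argument `(-2γ + e² - 2) / (e √(e² - 4γ))` of `arccosh` in `Ψ_γ(e)`. -/
noncomputable def PsiArg (γ e : ℝ) : ℝ :=
  (-2 * γ + e ^ 2 - 2) / (e * √(e ^ 2 - 4 * γ))

/-- `Ψ_γ(e) = (e/2) arccosh ((-2γ + e² - 2) / (e √(e² - 4γ)))`, for `e` in `PsiDomain γ`. -/
noncomputable def Psi (γ e : ℝ) : ℝ := e / 2 * Real.arcosh (PsiArg γ e)

end CatenaryBVP

namespace CatenaryBVP

open Real Set Filter Topology

/-! Scaling by `r` (`e = E / r`, `x = h / r`, `γ = c / r ^ 2`) turns the equation into `cosh (2 * x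
/ e) = PsiArg γ e` with `e > 2 * √γ`. A solution exists by the intermediate value theorem: the right
side blows up at `2 * √γ` and equals `1` at `γ + 1`, while `cosh` stays bounded and at least `1`.
Since `cosh ≥ 1`, every solution has `e ≤ γ + 1` and satisfies `Psi γ e = x`, so strict monotonicity
of `Psi γ` (`deriv_psi_neg`) gives uniqueness. -/

lemma sub_pos_of_two_sqrt_lt {γ e : ℝ} (hγ : 1 < γ) (he : 2 * √γ < e) :
    0 < e ∧ 0 < e ^ 2 - 4 * γ := by
  have h0 : 0 < √γ := sqrt_pos.2 (by linarith)
  have h1 : √γ ^ 2 = γ := sq_sqrt (by linarith)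
  exact ⟨by linarith, by nlinarith⟩

lemma two_sqrt_lt_of_sq_lt {γ e : ℝ} (he : 0 < e) (h : 4 * γ < e ^ 2) : 2 * √γ < e := by
  have h1 : √γ < e / 2 := (sqrt_lt' (by linarith)).2 (by linarith [div_pow e 2 2])
  linarith

/-- Source of the threshold `γ + 1`, and of the square root in the derivative of `arcosh`. -/
lemma psiArg_sq_sub_one {γ e : ℝ} (he : 0 < e) (hw : 0 < e ^ 2 - 4 * γ) :
    PsiArg γ e ^ 2 - 1 = 4 * ((γ + 1) ^ 2 - e ^ 2) / (e * √(e ^ 2 - 4 * γ)) ^ 2 := by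
  have h := sq_sqrt hw.le
  have hs := sqrt_pos.2 hw
  unfold PsiArg
  rw [div_pow, div_sub_one (by positivity), mul_pow, h]
  congr 1
  ring

lemma psiArg_pos {γ e : ℝ} (hγ : 1 < γ) (he : 2 * √γ < e) : 0 < PsiArg γ e := by
  obtain ⟨h0, hw⟩ := sub_pos_of_two_sqrt_lt hγ he
  have hs := sqrt_pos.2 hw
  exact div_pos (by linarith) (by positivity)

/-- For `e > 2√γ`, the number `PsiArg γ e` is at least `1` exactly when `e ≤ γ + 1`. -/
lemma one_le_psiArg_iff {γ e : ℝ} (hγ : 1 < γ) (he : 2 * √γ < e) :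
    1 ≤ PsiArg γ e ↔ e ≤ γ + 1 := by
  obtain ⟨h0, hw⟩ := sub_pos_of_two_sqrt_lt hγ he
  have hs := sqrt_pos.2 hw
  have hD : 0 < (e * √(e ^ 2 - 4 * γ)) ^ 2 := by positivity
  rw [← one_le_sq_iff₀ (psiArg_pos hγ he).le, ← sub_nonneg, psiArg_sq_sub_one h0 hw,
    le_div_iff₀ hD, zero_mul, ← sq_le_sq₀ h0.le (by linarith)]
  constructor <;> intro h <;> linarith

lemma one_lt_psiArg {γ e : ℝ} (hγ : 1 < γ) (he : 2 * √γ < e) (he' : e < γ + 1) :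
    1 < PsiArg γ e := by
  obtain ⟨h0, hw⟩ := sub_pos_of_two_sqrt_lt hγ he
  have hs := sqrt_pos.2 hw
  rw [← one_lt_sq_iff₀ (psiArg_pos hγ he).le, ← sub_pos, psiArg_sq_sub_one h0 hw]
  have : 0 < (γ + 1) ^ 2 - e ^ 2 := by nlinarith
  positivity

lemma psiArg_add_one {γ : ℝ} (hγ : 1 < γ) : PsiArg γ (γ + 1) = 1 := by
  have h : √((γ + 1) ^ 2 - 4 * γ) = γ - 1 := by
    rw [show (γ + 1) ^ 2 - 4 * γ = (γ - 1) ^ 2 by ring, sqrt_sq (by linarith)]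
  have h1 : γ - 1 ≠ 0 := by linarith
  unfold PsiArg
  rw [h, div_eq_one_iff_eq (mul_ne_zero (by linarith) h1)]
  ring

lemma two_sqrt_lt_add_one {γ : ℝ} (hγ : 1 < γ) : 2 * √γ < γ + 1 :=
  two_sqrt_lt_of_sq_lt (by linarith) (by nlinarith [sq_pos_of_pos (sub_pos.2 hγ)])

lemma hasDerivAt_psiArg {γ e : ℝ} (he : 0 < e) (hw : 0 < e ^ 2 - 4 * γ) :
    HasDerivAt (PsiArg γ)
      (-(4 * (2 * γ * (γ + 1) - e ^ 2)) / (e ^ 2 * √(e ^ 2 - 4 * γ) ^ 3)) e := by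
  have hs := sqrt_pos.2 hw
  have h2 := sq_sqrt hw.le
  have hsq : HasDerivAt (fun x : ℝ => x ^ 2) (2 * e) e := by simpa using hasDerivAt_pow 2 e
  have hN : HasDerivAt (fun x : ℝ => -2 * γ + x ^ 2 - 2) (2 * e) e :=
    (hsq.const_add _).sub_const _
  have hD := (hasDerivAt_id' e).mul ((hsq.sub_const (4 * γ)).sqrt hw.ne')
  have := hN.div hD (mul_pos he hs).ne'
  refine this.congr_deriv ?_
  simp only [Pi.mul_apply]
  clear this hN hD
  generalize √(e ^ 2 - 4 * γ) = w at hs h2 ⊢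
  -- Eliminating `γ` leaves an identity of rational functions in `e` and `w`.
  obtain rfl : γ = (e ^ 2 - w ^ 2) / 4 := by linarith
  field_simp
  ring

lemma continuousOn_psiArg {γ : ℝ} (hγ : 1 < γ) : ContinuousOn (PsiArg γ) (Ioi (2 * √γ)) := by
  intro e he
  obtain ⟨h0, hw⟩ := sub_pos_of_two_sqrt_lt hγ he
  exact (hasDerivAt_psiArg h0 hw).continuousAt.continuousWithinAt

/-- The only positive term of the derivative is `arcosh A / 2` with `A = PsiArg γ e`. The bound `t ≤
sinh t` at `t = arcosh A` replaces it by `√(A ^ 2 - 1) / 2`, leaving an algebraic inequality. -/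
lemma deriv_psi_neg {γ e : ℝ} (hγ : 1 < γ) (he : 2 * √γ < e) (he' : e < γ + 1) :
    deriv (Psi γ) e < 0 := by
  obtain ⟨h0, hw⟩ := sub_pos_of_two_sqrt_lt hγ he
  have hA := one_lt_psiArg hγ he he'
  have hw0 := sqrt_pos.2 hw
  have hw2 := sq_sqrt hw.le
  have hS : 0 < (γ + 1) ^ 2 - e ^ 2 := by nlinarith
  have hs0 := sqrt_pos.2 hS
  have hs2 := sq_sqrt hS.le
  have hsqrt : √(PsiArg γ e ^ 2 - 1) = 2 * √((γ + 1) ^ 2 - e ^ 2) / (e * √(e ^ 2 - 4 * γ)) := by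
    rw [psiArg_sq_sub_one h0 hw]
    refine (sqrt_eq_iff_mul_self_eq (by positivity) (by positivity)).2 ?_
    rw [← sq, div_pow, mul_pow 2, hs2]
    norm_num
  have hd : HasDerivAt (Psi γ) _ e := ((hasDerivAt_id' e).div_const 2).mul
    ((hasDerivAt_arcosh hA).comp e (hasDerivAt_psiArg h0 hw))
  rw [hd.deriv]
  have hle : arcosh (PsiArg γ e) ≤ √(PsiArg γ e ^ 2 - 1) := by
    rw [← sinh_arcosh hA.le]
    exact self_le_sinh_iff.2 (arcosh_nonneg hA.le)
  rw [hsqrt] at hle ⊢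
  set w := √(e ^ 2 - 4 * γ)
  set s := √((γ + 1) ^ 2 - e ^ 2)
  have hwe : w < e := by nlinarith
  -- This is `(γ + 1) ^ 2 < 2 * γ * (γ + 1)`, that is, `γ > 1`.
  have hM : s ^ 2 < 2 * γ * (γ + 1) - e ^ 2 := by nlinarith
  have key : 2 * s / (e * w) < 2 * (2 * γ * (γ + 1) - e ^ 2) / (s * w ^ 2) := by
    rw [div_lt_div_iff₀ (by positivity) (by positivity)]
    have h1 : s ^ 2 * w < (2 * γ * (γ + 1) - e ^ 2) * e :=
      mul_lt_mul'' hM hwe (by positivity) hw0.le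
    nlinarith [mul_lt_mul_of_pos_right h1 hw0]
  have hrw : e / 2 * ((2 * s / (e * w))⁻¹ *
      (-(4 * (2 * γ * (γ + 1) - e ^ 2)) / (e ^ 2 * w ^ 3))) =
      -(2 * (2 * γ * (γ + 1) - e ^ 2) / (s * w ^ 2)) / 2 := by
    field_simp
    ring
  rw [hrw]
  linarith

lemma strictAntiOn_psi {γ : ℝ} (hγ : 1 < γ) : StrictAntiOn (Psi γ) (PsiDomain γ) := by
  refine strictAntiOn_of_deriv_neg (convex_Ioc _ _) ?_ ?_
  · refine (continuousOn_id.div_const 2).mul (continuousOn_arcosh.comp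
      ((continuousOn_psiArg hγ).mono Ioc_subset_Ioi_self) ?_)
    exact fun e he => (one_le_psiArg_iff hγ he.1).2 he.2
  · intro e he
    rw [interior_Ioc] at he
    exact deriv_psi_neg hγ he.1 he.2

/-- The numerator tends to `2 * γ - 2 > 0`, the denominator to `0` from above. -/
lemma tendsto_psiArg_atTop {γ : ℝ} (hγ : 1 < γ) :
    Tendsto (PsiArg γ) (𝓝[>] (2 * √γ)) atTop := by
  have h1 : (2 * √γ) ^ 2 = 4 * γ := by rw [mul_pow, sq_sqrt (by linarith)]; norm_num
  have hN : Tendsto (fun e : ℝ => -2 * γ + e ^ 2 - 2) (𝓝[>] (2 * √γ)) (𝓝 (2 * γ - 2)) := by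
    have : ContinuousAt (fun e : ℝ => -2 * γ + e ^ 2 - 2) (2 * √γ) := by fun_prop
    convert this.tendsto.mono_left nhdsWithin_le_nhds using 2
    rw [h1]; ring
  have hD : Tendsto (fun e : ℝ => e * √(e ^ 2 - 4 * γ)) (𝓝[>] (2 * √γ)) (𝓝[>] 0) := by
    refine tendsto_nhdsWithin_iff.2 ⟨?_, ?_⟩
    · have : ContinuousAt (fun e : ℝ => e * √(e ^ 2 - 4 * γ)) (2 * √γ) := by fun_prop
      convert this.tendsto.mono_left nhdsWithin_le_nhds using 2
      rw [h1]; simp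
    · filter_upwards [self_mem_nhdsWithin] with e he
      obtain ⟨h0, hw⟩ := sub_pos_of_two_sqrt_lt hγ he
      exact mul_pos h0 (sqrt_pos.2 hw)
  exact hN.pos_mul_atTop (by linarith) (tendsto_inv_nhdsGT_zero.comp hD)

/-- The equation `cosh (2x/e) = PsiArg γ e` amounts to `Psi γ e = x` on `PsiDomain γ`. -/
lemma psi_eq_of_cosh_eq {γ x e : ℝ} (hγ : 1 < γ) (hx : 0 < x) (he : 2 * √γ < e)
    (h : cosh (2 * x / e) = PsiArg γ e) : e ∈ PsiDomain γ ∧ Psi γ e = x := by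
  obtain ⟨h0, -⟩ := sub_pos_of_two_sqrt_lt hγ he
  refine ⟨⟨he, (one_le_psiArg_iff hγ he).1 (h ▸ one_le_cosh _)⟩, ?_⟩
  rw [Psi, ← h, arcosh_cosh (by positivity)]
  field_simp

lemma exists_cosh_eq_psiArg {γ x : ℝ} (hγ : 1 < γ) :
    ∃ e, 2 * √γ < e ∧ cosh (2 * x / e) = PsiArg γ e := by
  have hγ0 : 0 < 2 * √γ := by have := sqrt_pos.2 (zero_lt_one.trans hγ); positivity
  have hcont : ContinuousOn (fun e => cosh (2 * x / e)) (Ici (2 * √γ)) :=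
    continuous_cosh.comp_continuousOn
      (continuousOn_const.div continuousOn_id fun e he => (hγ0.trans_le he).ne')
  have hlim : Tendsto (fun e => cosh (2 * x / e)) (𝓝[>] (2 * √γ)) (𝓝 (cosh (2 * x / (2 * √γ)))) :=
    (hcont _ self_mem_Ici).mono_left (nhdsWithin_mono _ Ioi_subset_Ici_self)
  -- The limit of `cosh` plus `1` separates the two sides near `2 * √γ`.
  have hev := (hlim.eventually_lt_const (lt_add_one _)).and
    ((tendsto_psiArg_atTop hγ).eventually_gt_atTop (cosh (2 * x / (2 * √γ)) + 1))
  obtain ⟨a, ⟨ha1, ha2⟩, ha, hab⟩ :=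
    (hev.and (Ioo_mem_nhdsGT (two_sqrt_lt_add_one hγ))).exists
  have hsub : Icc a (γ + 1) ⊆ Ioi (2 * √γ) := fun e he => ha.trans_le he.1
  obtain ⟨e, he, heq⟩ := intermediate_value_Icc hab.le
    (((hcont.mono (Ioi_subset_Ici_self)).sub (continuousOn_psiArg hγ)).mono hsub)
    (show (0 : ℝ) ∈ Icc _ _ from ⟨(sub_neg.2 (ha1.trans ha2)).le, by
      simp only [Pi.sub_apply, psiArg_add_one hγ]
      linarith [one_le_cosh (2 * x / (γ + 1))]⟩)
  exact ⟨e, hsub he, sub_eq_zero.1 heq⟩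

lemma concaveRHS_eq_psiArg {r c E : ℝ} (hr : 0 < r) :
    concaveRHS r c E = PsiArg (c / r ^ 2) (E / r) := by
  have h : √((E / r) ^ 2 - 4 * (c / r ^ 2)) = √(E ^ 2 - 4 * c) / r := by
    rw [show (E / r) ^ 2 - 4 * (c / r ^ 2) = (E ^ 2 - 4 * c) / r ^ 2 by field_simp,
      sqrt_div' _ (by positivity), sqrt_sq hr.le]
  have h' : -2 * (c / r ^ 2) + (E / r) ^ 2 - 2 = (-2 * r ^ 2 + E ^ 2 - 2 * c) / r ^ 2 := by
    field_simp
    ring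
  rw [concaveRHS, PsiArg, h, h', div_mul_div_comm, ← sq, div_div_div_cancel_right₀ (by positivity)]

end CatenaryBVP

open CatenaryBVP in
theorem lemma3p4 (h r c : ℝ) (hh : 0 < h) (hr : 0 < r)
    (hω : h / r ≤ CatenaryBVP.omega) (hc : r ^ 2 < c) :
    (∃! E : ℝ, (0 < E ∧ 4 * c < E ^ 2) ∧
      Real.cosh (2 * h / E) = CatenaryBVP.concaveRHS r c E) ∧
    (∀ e ∈ CatenaryBVP.PsiDomain (c / r ^ 2), 1 ≤ CatenaryBVP.PsiArg (c / r ^ 2) e) ∧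
    StrictAntiOn (CatenaryBVP.Psi (c / r ^ 2)) (CatenaryBVP.PsiDomain (c / r ^ 2)) := by
  have hγ : 1 < c / r ^ 2 := (one_lt_div (by positivity)).2 hc
  have hscale (E : ℝ) : 2 * h / E = 2 * (h / r) / (E / r) := by
    rw [← mul_div_assoc, div_div_div_cancel_right₀ hr.ne']
  have hdom (E : ℝ) : (0 < E ∧ 4 * c < E ^ 2) ↔ 2 * √(c / r ^ 2) < E / r := by
    have hiff : 4 * (c / r ^ 2) < (E / r) ^ 2 ↔ 4 * c < E ^ 2 := by
      rw [div_pow, ← mul_div_assoc, div_lt_div_iff_of_pos_right (by positivity)]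
    constructor
    · rintro ⟨h0, h1⟩
      exact two_sqrt_lt_of_sq_lt (div_pos h0 hr) (hiff.2 h1)
    · intro hE
      obtain ⟨h0, h1⟩ := sub_pos_of_two_sqrt_lt hγ hE
      exact ⟨(div_pos_iff_of_pos_right hr).1 h0, hiff.1 (sub_pos.1 h1)⟩
  have hanti := strictAntiOn_psi hγ
  refine ⟨?_, fun e he => (one_le_psiArg_iff hγ he.1).2 he.2, hanti⟩
  simp only [hdom, hscale, concaveRHS_eq_psiArg hr]
  obtain ⟨e, he, heq⟩ := exists_cosh_eq_psiArg (x := h / r) hγ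
  have her : r * e / r = e := mul_div_cancel_left₀ e hr.ne'
  refine ⟨r * e, by simp only [her]; exact ⟨he, heq⟩, ?_⟩
  rintro E ⟨hE, hEeq⟩
  obtain ⟨hm, hp⟩ := psi_eq_of_cosh_eq hγ (div_pos hh hr) he heq
  obtain ⟨hm', hp'⟩ := psi_eq_of_cosh_eq hγ (div_pos hh hr) hE hEeq
  rw [← hanti.injOn hm' hm (hp'.trans hp.symm), mul_div_cancel₀ E hr.ne']
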